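/- Let $N\ge 1$, $\alpha>0$ and $\lambda_E>0$. Let $A_1,\dots,A_{N+1}\in\mathbb R^2$ be the fixed nodes of an $N$-hop path, with $A_i\ne A_{i+1}$ for all $i$, and let $p_{A_1},\dots,p_{A_N}>0$ be the transmit powers; write $d_{xy}$ for the Euclidean distance of $x$ and $y$. Let the eavesdroppers $\Phi_E=\{E_1,E_2,\dots\}$ form a homogeneous Poisson point process of density $\lambda_E$ in $\mathbb R^2$. Let the fading powers $|h_{A_iA_{i+1}}|^2$ and $|h_{A_kE_j}|^2$ ($1\le i,k\le N$, $j\ge 1$) be independent exponential random variables with mean $1$, jointly independent of the locations $(E_j)_{j\ge1}$. The path uses decode-and-forward relaying and the eavesdroppers collude and combine the signals of all hops by maximal ratio combining, so that the SNR of the path and the combined SNR of the eavesdroppers are $$S=\min_{1\le i\le N}\frac{p_{A_i}|h_{A_iA_{i+1}}|^2}{d_{A_iA_{i+1}}^{\alpha}},\qquad I_E=\sum_{E_j\in\Phi_E}\sum_{k=1}^N\frac{p_{A_k}|h_{A_kE_j}|^2}{d_{A_kE_j}^{\alpha}}\in[0,\infty].$$ Then the secure connection probability of the path, $$\mathcal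 P_C=\mathbb P\Big(\tfrac1N\big(\log_2(1+S)-\log_2(1+I_E)\big)>0\Big),$$ is given by $$\mathcal P_C=\exp\Bigg[-\lambda_E\int_{\mathbb R^2}\Bigg(1-\prod_{k=1}^N\frac{1}{1+\frac{p_{A_k}}{d_{A_kx}^{\alpha}}\sum_{i=1}^N\frac{d_{A_iA_{i+1}}^{\alpha}}{p_{A_i}}}\Bigg)dx\Bigg],$$ where the integral of the nonnegative integrand takes its value in $[0,\infty]$ and $\exp(-\infty)=0$. If $\alpha>2$, the integral is finite. -/

import Mathlib

open MeasureTheory ProbabilityTheory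
open scoped ENNReal NNReal

noncomputable section

/-- The Euclidean plane, with its Euclidean distance and Lebesgue measure. -/
abbrev Plane : Type := EuclideanSpace ℝ (Fin 2)

/-- The counting measure `∑ j, δ_{E j}` of a sequence of points of the plane: its value on a
set `B` is the number of points that lie in `B`. -/
def pointMeasure (E : ℕ → Plane) : Measure Plane :=
  Measure.sum fun j => Measure.dirac (E j)

/-- The random points `E 0, E 1, …` enumerate a homogeneous Poisson point process of density
`lam` on the plane: the number of points in a bounded Borel set `B` is Poisson distributed with
mean `lam * area B`, and the numbers of points in finitely many pairwise disjoint bounded Borel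
sets are independent. -/
structure IsHomogeneousPPP {Ω : Type*} [MeasurableSpace Ω] (μ : Measure Ω) (lam : ℝ≥0)
    (E : ℕ → Ω → Plane) : Prop where
  measurable : ∀ j, Measurable (E j)
  count_law : ∀ B : Set Plane, MeasurableSet B → Bornology.IsBounded B →
    HasLaw (fun ω => pointMeasure (fun j => E j ω) B)
      ((poissonMeasure (lam * (volume B).toNNReal)).map (Nat.cast : ℕ → ℝ≥0∞)) μ
  count_indep : ∀ (n : ℕ) (B : Fin n → Set Plane), (∀ m, MeasurableSet (B m)) →
    (∀ m, Bornology.IsBounded (B m)) → Pairwise (fun m m' => Disjoint (B m) (B m')) →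
    iIndepFun (fun m ω => pointMeasure (fun j => E j ω) (B m)) μ

/-- All fading powers `|h|²` of the network: those of the `N` legitimate links, followed by those
of the links from the `k`-th transmitter to the `j`-th eavesdropper. -/
def fadingPower {Ω : Type*} {N : ℕ} (hA : Fin N → Ω → ℂ) (hE : Fin N → ℕ → Ω → ℂ) :
    Fin N ⊕ (Fin N × ℕ) → Ω → ℝ :=
  Sum.elim (fun i ω => ‖hA i ω‖ ^ 2) (fun kj ω => ‖hE kj.1 kj.2 ω‖ ^ 2)

/-- Rayleigh fading: the powers of all channel coefficients are independent and exponentially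
distributed with unit mean, and jointly independent of the eavesdroppers' locations. -/
structure IsRayleighFading {Ω : Type*} [MeasurableSpace Ω] (μ : Measure Ω) {N : ℕ}
    (hA : Fin N → Ω → ℂ) (hE : Fin N → ℕ → Ω → ℂ) (E : ℕ → Ω → Plane) : Prop where
  measurable_hA : ∀ i, Measurable (hA i)
  measurable_hE : ∀ k j, Measurable (hE k j)
  law : ∀ s, HasLaw (fadingPower hA hE s) (expMeasure 1) μ
  indep : iIndepFun (fadingPower hA hE) μ
  indep_locations : IndepFun (fun ω s => fadingPower hA hE s ω) (fun ω j => E j ω) μ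

/-- The received signal-to-noise ratio `p |h|² / d ^ α` at `y` from a transmitter at `x` with
power `p` and channel coefficient `h`, where `d` is the distance of `x` and `y`
(with values in `[0, ∞]`). -/
def snr (α p : ℝ) (h : ℂ) (x y : Plane) : ℝ≥0∞ :=
  ENNReal.ofReal (p * ‖h‖ ^ 2) / ENNReal.ofReal (dist x y ^ α)

/-- The SNR of a decode-and-forward route `A 0 → A 1 → ⋯ → A N`: the smallest SNR of its hops. -/
def routeSNR {N : ℕ} (α : ℝ) (A : Fin (N + 1) → Plane) (p : Fin N → ℝ) (h : Fin N → ℂ) : ℝ≥0∞ :=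
  ⨅ i : Fin N, snr α (p i) (h i) (A i.castSucc) (A i.succ)

/-- The combined SNR of colluding eavesdroppers `E 0, E 1, …` that apply maximal ratio combining
to the signals of all hops: the sum of the SNRs over all eavesdroppers and all transmitters. -/
def colludingSNR {N : ℕ} (α : ℝ) (A : Fin (N + 1) → Plane) (p : Fin N → ℝ)
    (E : ℕ → Plane) (h : Fin N → ℕ → ℂ) : ℝ≥0∞ :=
  ∑' j : ℕ, ∑ k : Fin N, snr α (p k) (h k j) (A k.castSucc) (E j)

/-- The logarithm to base 2 of an extended nonnegative number. -/
def elog2 (x : ℝ≥0∞) : EReal := ENNReal.log x / ((Real.log 2 : ℝ) : EReal)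

/-- The secrecy rate `(1/N) (log₂ (1 + S) - log₂ (1 + I))` of an `N`-hop route, before truncation
at `0`, for route SNR `S` and combined eavesdropping SNR `I`. -/
def secrecyRate (N : ℕ) (S I : ℝ≥0∞) : EReal :=
  ((1 / (N : ℝ) : ℝ) : EReal) * (elog2 (1 + S) - elog2 (1 + I))

/-- The secure connection probability of the route with colluding eavesdroppers: the probability
that the secrecy rate is positive. -/
def colludingSCP {Ω : Type*} [MeasurableSpace Ω] (μ : Measure Ω) {N : ℕ} (α : ℝ)
    (A : Fin (N + 1) → Plane) (p : Fin N → ℝ) (hA : Fin N → Ω → ℂ) (hE : Fin N → ℕ → Ω → ℂ)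
    (E : ℕ → Ω → Plane) : ℝ≥0∞ :=
  μ {ω | 0 < secrecyRate N (routeSNR α A p (fun i => hA i ω))
    (colludingSNR α A p (fun j => E j ω) (fun k j => hE k j ω))}

/-- The function `1 - ∏ k, 1 / (1 + p_k / d(A_k, x) ^ α * ∑ i, d(A_i, A_{i+1}) ^ α / p_i)` of a
possible eavesdropper location `x`. (Its values at the finitely many nodes are immaterial.) -/
def colludingIntegrand {N : ℕ} (α : ℝ) (A : Fin (N + 1) → Plane) (p : Fin N → ℝ)
    (x : Plane) : ℝ :=
  1 - ∏ k : Fin N, 1 / (1 + p k / dist (A k.castSucc) x ^ α *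
    ∑ i : Fin N, dist (A i.castSucc) (A i.succ) ^ α / p i)

end

/-! The proof integrates out the legitimate fading, the eavesdroppers' fading and the locations, in
that order. The rate is positive iff I < S. Put u_i = p_i/d_i^α and σ = ∑ 1/u_i. For a fixed level
t, S > t means that every hop power exceeds t/u_i, so independent exponential tails give probability
e^{-σt}: a minimum of exponentials is exponential. For fixed locations the required probability is
thus the Laplace transform of I at σ, a product of factors 1/(1 + σw) over eavesdroppers and
transmitters (`measure_tsum_lt_iInf_exponential`). Written as e^{-∑ f(E_j)}, with f a sum of terms
log(1 + σw), it averages over the Poisson process to exp(-λ∫(1 - e^{-f})) by the Laplace functional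
(`lintegral_expNeg_tsum`), and 1 - e^{-f} is the stated integrand off the nodes.

All sums live in [0,∞], where `expNeg` is continuous and bounded by 1. Hence no convergence
assumption is needed and divergent interference is covered. -/

noncomputable section

open Filter Topology

/-! ### Exponential and logarithm on [0,∞]. -/

namespace ENNReal

/-- The function `t ↦ exp (-t)` on `[0, ∞]`, with `exp (-∞) = 0`. -/
def expNeg (t : ℝ≥0∞) : ℝ≥0∞ := EReal.exp (-(t : EReal))

@[simp] lemma expNeg_zero : expNeg 0 = 1 := by simp [expNeg]

@[simp] lemma expNeg_top : expNeg ∞ = 0 := by simp [expNeg]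

lemma expNeg_add (s t : ℝ≥0∞) : expNeg (s + t) = expNeg s * expNeg t := by
  rw [expNeg, expNeg, expNeg, ← EReal.exp_add, EReal.coe_ennreal_add,
    EReal.neg_add (Or.inl (EReal.coe_ennreal_ne_bot s)) (Or.inr (EReal.coe_ennreal_ne_bot t)),
    sub_eq_add_neg]

lemma expNeg_sum {ι : Type*} (s : Finset ι) (t : ι → ℝ≥0∞) :
    expNeg (∑ i ∈ s, t i) = ∏ i ∈ s, expNeg (t i) := by
  classical
  induction s using Finset.induction_on with
  | empty => simp
  | insert a s ha ih => rw [Finset.sum_insert ha, Finset.prod_insert ha, expNeg_add, ih]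

lemma expNeg_mul_natCast (t : ℝ≥0∞) (n : ℕ) : expNeg (t * n) = expNeg t ^ n := by
  have h := expNeg_sum (Finset.range n) fun _ => t
  simpa [mul_comm] using h

lemma antitone_expNeg : Antitone expNeg := fun _ _ h =>
  EReal.exp_monotone (EReal.neg_le_neg_iff.2 (EReal.coe_ennreal_le_coe_ennreal_iff.2 h))

lemma expNeg_le_one (t : ℝ≥0∞) : expNeg t ≤ 1 :=
  expNeg_zero ▸ antitone_expNeg zero_le

lemma expNeg_ne_top (t : ℝ≥0∞) : expNeg t ≠ ∞ := ((expNeg_le_one t).trans_lt one_lt_top).ne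

lemma continuous_expNeg : Continuous expNeg :=
  ENNReal.continuous_exp.comp (continuous_neg.comp continuous_coe_ennreal_ereal)

@[fun_prop]
lemma measurable_expNeg : Measurable expNeg := continuous_expNeg.measurable

lemma expNeg_ofReal {r : ℝ} (hr : 0 ≤ r) :
    expNeg (ENNReal.ofReal r) = ENNReal.ofReal (Real.exp (-r)) := by
  rw [expNeg, EReal.coe_ennreal_ofReal, max_eq_left hr, ← EReal.coe_neg, EReal.exp_coe]

/-- The function `t ↦ log (1 + t)` on `[0, ∞]`. -/
def logOneAdd (t : ℝ≥0∞) : ℝ≥0∞ := (ENNReal.log (1 + t)).toENNReal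

@[fun_prop]
lemma measurable_logOneAdd : Measurable logOneAdd := by
  unfold logOneAdd
  fun_prop

lemma expNeg_logOneAdd (t : ℝ≥0∞) : expNeg (logOneAdd t) = (1 + t)⁻¹ := by
  rw [expNeg, logOneAdd, EReal.coe_toENNReal (zero_le_log_iff.2 le_self_add), EReal.exp_neg,
    ENNReal.exp_log]

end ENNReal

open ENNReal

/-! ### Laplace transforms of the Poisson and exponential laws. -/

/-- The Laplace transform of the Poisson distribution. -/
lemma lintegral_expNeg_poissonMeasure (r : ℝ≥0) (c : ℝ≥0∞) :
    ∫⁻ x, expNeg (c * x) ∂((poissonMeasure r).map (Nat.cast : ℕ → ℝ≥0∞)) =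
      expNeg (r * (1 - expNeg c)) := by
  rw [lintegral_map (by fun_prop) .of_discrete, poissonMeasure, lintegral_sum_measure]
  simp only [lintegral_smul_measure, lintegral_dirac, expNeg_mul_natCast, smul_eq_mul]
  obtain ⟨x, hx⟩ : ∃ x : ℝ≥0, expNeg c = x := ⟨_, (ENNReal.coe_toNNReal (expNeg_ne_top c)).symm⟩
  have hx1 : (x : ℝ) ≤ 1 := by
    have := expNeg_le_one c
    rw [hx] at this
    exact_mod_cast this
  have hs : HasSum (fun n : ℕ => Real.exp (-r) * r ^ n / n.factorial * x ^ n)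
      (Real.exp (-(r * (1 - x)))) := by
    convert! (NormedSpace.expSeries_div_hasSum_exp ((r * x : ℝ))).mul_left (Real.exp (-r)) using 1
    · ext n; rw [mul_pow]; ring
    · rw [← Real.exp_eq_exp_ℝ, ← Real.exp_add]; ring_nf
  have hc : (r : ℝ≥0∞) * (1 - x) = ENNReal.ofReal (r * (1 - x)) := by
    rw [ENNReal.ofReal_mul r.coe_nonneg, ENNReal.ofReal_sub _ x.coe_nonneg]
    simp
  rw [hx, hc, expNeg_ofReal (mul_nonneg r.coe_nonneg (by linarith)), ← hs.tsum_eq,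
    ENNReal.ofReal_tsum_of_nonneg (fun n => by positivity) hs.summable]
  refine tsum_congr fun n => ?_
  rw [ENNReal.ofReal_mul (by positivity), ENNReal.ofReal_pow x.coe_nonneg]
  simp

instance : IsProbabilityMeasure (expMeasure 1) := isProbabilityMeasure_expMeasure one_pos

lemma expMeasure_eq_withDensity (r : ℝ) :
    expMeasure r = volume.withDensity (exponentialPDF r) := rfl

lemma ae_expMeasure_one_pos : ∀ᵐ x ∂(expMeasure 1), 0 < x := by
  rw [ae_iff]
  have h : {x : ℝ | ¬ 0 < x} = Set.Iic 0 := by ext; simp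
  rw [h, expMeasure_eq_withDensity, withDensity_apply _ measurableSet_Iic,
    lintegral_exponentialPDF_eq_antiDeriv one_pos]
  simp

/-- The Laplace transform of the exponential distribution with unit mean. -/
lemma lintegral_expNeg_expMeasure_one (c : ℝ≥0∞) :
    ∫⁻ x, expNeg (c * ENNReal.ofReal x) ∂(expMeasure 1) = (1 + c)⁻¹ := by
  induction c with
  | top =>
    -- ∞ * x is ∞ only for x > 0, which holds almost surely.
    rw [lintegral_congr_ae (g := 0)]
    · simp
    · filter_upwards [ae_expMeasure_one_pos] with x hx
      simp [ENNReal.top_mul, hx]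
  | coe c =>
    have hc : 0 < 1 + (c : ℝ) := by positivity
    have hm : Measurable (exponentialPDF 1) :=
      (measurable_exponentialPDFReal 1).ennreal_ofReal
    rw [expMeasure_eq_withDensity, lintegral_withDensity_eq_lintegral_mul _ hm (by fun_prop)]
    -- Tilting the rate-1 density by e^{-cx} gives (1 + c)⁻¹ times the density of rate 1 + c.
    have : ∀ x, (exponentialPDF 1 * fun x => expNeg (c * ENNReal.ofReal x)) x =
        (1 + c : ℝ≥0∞)⁻¹ * exponentialPDF (1 + c) x := by
      intro x
      rw [Pi.mul_apply]
      rcases lt_or_ge x 0 with hx | hx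
      · rw [exponentialPDF_of_neg hx, exponentialPDF_of_neg hx]; simp
      · have h1 : (1 + c : ℝ≥0∞) = ENNReal.ofReal (1 + c) := by
          rw [ENNReal.ofReal_add zero_le_one c.coe_nonneg]; simp
        have h2 : (c : ℝ≥0∞) = ENNReal.ofReal c := by simp
        rw [exponentialPDF_of_nonneg hx, exponentialPDF_of_nonneg hx, h1, h2,
          ← ENNReal.ofReal_mul c.coe_nonneg, expNeg_ofReal (mul_nonneg c.coe_nonneg hx),
          ← ENNReal.ofReal_inv_of_pos hc, ← ENNReal.ofReal_mul (by positivity),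
          ← ENNReal.ofReal_mul (by positivity)]
        congr 1
        rw [← mul_assoc, inv_mul_cancel₀ hc.ne', one_mul, one_mul, one_mul, ← Real.exp_add]
        ring_nf
    simp_rw [this]
    rw [lintegral_const_mul', lintegral_exponentialPDF_eq_one hc, mul_one]
    simp

/-- The tail of the exponential distribution with unit mean. -/
lemma expMeasure_one_lt_ofReal (t : ℝ≥0∞) :
    expMeasure 1 {x | t < ENNReal.ofReal x} = expNeg t := by
  induction t with
  | top => simp
  | coe t =>
    have h : {x : ℝ | (t : ℝ≥0∞) < ENNReal.ofReal x} = (Set.Iic (t : ℝ))ᶜ := by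
      ext x
      simp [ENNReal.lt_ofReal_iff_toReal_lt]
    rw [h, prob_compl_eq_one_sub measurableSet_Iic, expMeasure_eq_withDensity,
      withDensity_apply _ measurableSet_Iic, lintegral_exponentialPDF_eq_antiDeriv one_pos,
      if_pos t.coe_nonneg, ← ENNReal.ofReal_coe_nnreal, expNeg_ofReal t.coe_nonneg, ← ENNReal.ofReal_one,
      ← ENNReal.ofReal_sub _ (by simp)]
    simp

lemma lintegral_pointMeasure {f : Plane → ℝ≥0∞} (hf : Measurable f) (E : ℕ → Plane) :
    ∫⁻ x, f x ∂(pointMeasure E) = ∑' j, f (E j) := by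
  rw [pointMeasure, lintegral_sum_measure]
  exact tsum_congr fun j => lintegral_dirac' _ hf

/-! ### Laplace functional of the Poisson process. -/

namespace IsHomogeneousPPP

variable {Ω : Type*} [MeasurableSpace Ω] {μ : Measure Ω} {lam : ℝ≥0} {E : ℕ → Ω → Plane}

lemma measurable_count (h : IsHomogeneousPPP μ lam E) {B : Set Plane} (hB : MeasurableSet B) :
    Measurable fun ω => pointMeasure (fun j => E j ω) B := by
  have hEB : ∀ ω, pointMeasure (fun j => E j ω) B = ∑' j, B.indicator 1 (E j ω) := by
    intro ω
    rw [pointMeasure, Measure.sum_apply _ hB]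
    exact tsum_congr fun j => Measure.dirac_apply' _ hB
  simp_rw [hEB]
  exact .tsum fun j => (measurable_one.indicator hB).comp (h.measurable j)

lemma iIndepFun_count (h : IsHomogeneousPPP μ lam E) {ι : Type*} [Fintype ι] {B : ι → Set Plane}
    (hB : ∀ i, MeasurableSet (B i)) (hb : ∀ i, Bornology.IsBounded (B i))
    (hd : Pairwise fun i j => Disjoint (B i) (B j)) :
    iIndepFun (fun i ω => pointMeasure (fun j => E j ω) (B i)) μ := by
  have e := Fintype.equivFin ι
  have := (h.count_indep _ (B ∘ e.symm) (fun _ => hB _) (fun _ => hb _)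
    (fun i j hij => hd (e.symm.injective.ne hij))).precomp e.injective
  simpa [Function.comp_def] using this

lemma lintegral_expNeg_count (h : IsHomogeneousPPP μ lam E) (c : ℝ≥0∞) {B : Set Plane}
    (hB : MeasurableSet B) (hb : Bornology.IsBounded B) :
    ∫⁻ ω, expNeg (c * pointMeasure (fun j => E j ω) B) ∂μ =
      expNeg (lam * ((1 - expNeg c) * volume B)) := by
  have := (h.count_law B hB hb).lintegral_comp (f := fun x => expNeg (c * x)) (by fun_prop)
  rw [this, lintegral_expNeg_poissonMeasure, ENNReal.coe_mul,
    ENNReal.coe_toNNReal hb.measure_lt_top.ne]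
  ring_nf

/-- The Laplace functional of a Poisson point process at a simple function of bounded support. -/
lemma lintegral_expNeg_simpleFunc (h : IsHomogeneousPPP μ lam E) (g : SimpleFunc Plane ℝ≥0∞)
    (hg : Bornology.IsBounded (Function.support g)) :
    ∫⁻ ω, expNeg (∑' j, g (E j ω)) ∂μ = expNeg (lam * ∫⁻ x, (1 - expNeg (g x))) := by
  classical
  -- The level set of 0 is unbounded, so the count law does not apply to it; it contributes nothing.
  let s := g.range.filter (· ≠ 0)
  have hb : ∀ c : s, Bornology.IsBounded (g ⁻¹' {(c : ℝ≥0∞)}) := fun c =>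
    hg.subset fun x hx => by
      have hc := (Finset.mem_filter.1 c.2).2
      rw [Function.mem_support, Set.mem_singleton_iff.1 hx]
      exact hc
  have hm : ∀ c : ℝ≥0∞, MeasurableSet (g ⁻¹' {c}) := g.measurableSet_fiber
  have hd : Pairwise fun c d : s => Disjoint (g ⁻¹' {(c : ℝ≥0∞)}) (g ⁻¹' {(d : ℝ≥0∞)}) :=
    fun c d hcd => Disjoint.preimage _ (Set.disjoint_singleton.2 (Subtype.coe_ne_coe.2 hcd))
  have hind := (h.iIndepFun_count (fun c : s => hm c) hb hd).comp
    (fun c x => expNeg ((c : ℝ≥0∞) * x)) (fun c => by fun_prop)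
  -- Used twice: for the counting measure with F the identity, and for Lebesgue measure with F = 1 -
  -- `expNeg`.
  have hsum : ∀ (ν : Measure Plane) (F : ℝ≥0∞ → ℝ≥0∞), F 0 = 0 →
      ∫⁻ x, F (g x) ∂ν = ∑ c : s, F c * ν (g ⁻¹' {(c : ℝ≥0∞)}) := by
    intro ν F hF
    have h1 := (g.map F).lintegral_eq_lintegral ν
    rw [SimpleFunc.map_lintegral] at h1
    simp only [SimpleFunc.coe_map, Function.comp_apply] at h1
    rw [h1, Finset.sum_coe_sort s fun c => F c * ν (g ⁻¹' {c})]
    refine (Finset.sum_filter_of_ne (p := (· ≠ 0)) ?_).symm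
    rintro c - hc rfl
    exact hc (by rw [hF, zero_mul])
  simp_rw [← lintegral_pointMeasure g.measurable]
  rw [hsum volume (fun c => 1 - expNeg c) (by simp)]
  have h2 : ∀ ω, ∫⁻ x, g x ∂(pointMeasure fun j => E j ω) =
      ∑ c : s, (c : ℝ≥0∞) * pointMeasure (fun j => E j ω) (g ⁻¹' {(c : ℝ≥0∞)}) :=
    fun ω => hsum _ (fun c => c) rfl
  simp_rw [h2, expNeg_sum]
  refine (lintegral_prod_eq_prod_lintegral_of_indepFun Finset.univ _ hind
    fun c => measurable_expNeg.comp ((h.measurable_count (hm c)).const_mul _)).trans ?_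
  rw [Finset.mul_sum, expNeg_sum]
  exact Finset.prod_congr rfl fun c _ => h.lintegral_expNeg_count c (hm c) (hb c)

/-- The Laplace functional of a homogeneous Poisson point process. -/
theorem lintegral_expNeg_tsum [IsProbabilityMeasure μ] (h : IsHomogeneousPPP μ lam E)
    {f : Plane → ℝ≥0∞} (hf : Measurable f) :
    ∫⁻ ω, expNeg (∑' j, f (E j ω)) ∂μ = expNeg (lam * ∫⁻ x, (1 - expNeg (f x))) := by
  let B : ℕ → Set Plane := fun n => Metric.closedBall 0 n
  -- Truncating to growing balls gives bounded supports and keeps the approximation increasing to f.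
  let g : ℕ → SimpleFunc Plane ℝ≥0∞ := fun n => (SimpleFunc.eapprox f n).restrict (B n)
  have hBm : ∀ n, MeasurableSet (B n) := fun n => measurableSet_closedBall
  have hg : ∀ n x, g n x = (B n).indicator (SimpleFunc.eapprox f n) x := fun n x =>
    SimpleFunc.restrict_apply _ (hBm n) x
  have hgm : ∀ x, Monotone fun n => g n x := by
    intro x m n hmn
    simp only [hg]
    refine (Set.indicator_le_indicator (SimpleFunc.monotone_eapprox f hmn x)).trans
      (Set.indicator_le_indicator_of_subset
        (Metric.closedBall_subset_closedBall (Nat.cast_le.2 hmn)) (fun _ => zero_le) x)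
  have hgt : ∀ x, Tendsto (fun n => g n x) atTop (𝓝 (f x)) := by
    intro x
    refine (SimpleFunc.tendsto_eapprox hf x).congr' ?_
    obtain ⟨m, hm⟩ := exists_nat_ge ‖x‖
    filter_upwards [eventually_ge_atTop m] with n hn
    rw [hg, Set.indicator_of_mem]
    simpa [B] using hm.trans (Nat.cast_le.2 hn)
  have hgb : ∀ n, Bornology.IsBounded (Function.support (g n)) := fun n =>
    (Metric.isBounded_closedBall (x := (0 : Plane)) (r := n)).subset fun x hx => by
      rw [Function.mem_support, hg] at hx
      exact Set.mem_of_indicator_ne_zero hx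
  have hL : Tendsto (fun n => ∫⁻ ω, expNeg (∑' j, g n (E j ω)) ∂μ) atTop
      (𝓝 (∫⁻ ω, expNeg (∑' j, f (E j ω)) ∂μ)) := by
    refine tendsto_lintegral_of_dominated_convergence 1 (fun n => ?_)
      (fun n => .of_forall fun ω => expNeg_le_one _) (by simp) (.of_forall fun ω => ?_)
    · exact measurable_expNeg.comp (.tsum fun j => (g n).measurable.comp (h.measurable j))
    · refine (continuous_expNeg.tendsto _).comp ?_
      simp_rw [← lintegral_pointMeasure hf, ← lintegral_pointMeasure (g _).measurable]
      exact lintegral_tendsto_of_tendsto_of_monotone (fun n => (g n).measurable.aemeasurable)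
        (.of_forall hgm) (.of_forall hgt)
  have hR : Tendsto (fun n => expNeg (lam * ∫⁻ x, (1 - expNeg (g n x)))) atTop
      (𝓝 (expNeg (lam * ∫⁻ x, (1 - expNeg (f x))))) := by
    -- The limiting integral may be infinite, so monotone rather than dominated convergence is used
    -- here.
    refine (continuous_expNeg.tendsto _).comp (ENNReal.Tendsto.const_mul ?_ (.inr coe_ne_top))
    refine lintegral_tendsto_of_tendsto_of_monotone (fun n => ?_) (.of_forall fun x => ?_)
      (.of_forall fun x => ?_)
    · exact (measurable_const.sub (measurable_expNeg.comp (g n).measurable)).aemeasurable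
    · exact fun m n hmn => tsub_le_tsub_left (antitone_expNeg (hgm x hmn)) 1
    · exact ENNReal.Tendsto.sub tendsto_const_nhds ((continuous_expNeg.tendsto _).comp (hgt x))
        (.inl one_ne_top)
  refine tendsto_nhds_unique hL (hR.congr fun n => ?_)
  exact (h.lintegral_expNeg_simpleFunc (g n) (hgb n)).symm

end IsHomogeneousPPP

/-! ### Independence, conditioning and exponential families. -/

section Independence

variable {Ω : Type*} [MeasurableSpace Ω] {μ : Measure Ω}

/-- Each block generates the supremum of its coordinates' σ-algebras, and suprema over disjoint
index sets are independent. -/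
lemma ProbabilityTheory.iIndepFun.indepFun_inl_inr {ι κ β : Type*} [MeasurableSpace β]
    {X : ι ⊕ κ → Ω → β} (h : iIndepFun X μ) (hX : ∀ s, Measurable (X s)) :
    IndepFun (fun ω i => X (.inl i) ω) (fun ω j => X (.inr j) ω) μ := by
  have hd : Disjoint (Set.range (Sum.inl : ι → ι ⊕ κ)) (Set.range Sum.inr) :=
    Set.isCompl_range_inl_range_inr.disjoint
  have key := indep_iSup_of_disjoint (fun s => (hX s).comap_le) h hd
  refine indep_of_indep_of_le_left (indep_of_indep_of_le_right key ?_) ?_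
  · rw [MeasurableSpace.pi, MeasurableSpace.comap_iSup]
    refine iSup_le fun j => ?_
    rw [MeasurableSpace.comap_comp]
    exact le_iSup₂_of_le (Sum.inr j) ⟨j, rfl⟩ le_rfl
  · rw [MeasurableSpace.pi, MeasurableSpace.comap_iSup]
    refine iSup_le fun i => ?_
    rw [MeasurableSpace.comap_comp]
    exact le_iSup₂_of_le (Sum.inl i) ⟨i, rfl⟩ le_rfl

/-- Fubini for the product law: conditioning on V amounts to freezing its value. -/
lemma ProbabilityTheory.IndepFun.measure_mk_mem [IsProbabilityMeasure μ] {β γ : Type*}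
    [MeasurableSpace β] [MeasurableSpace γ] {U : Ω → β} {V : Ω → γ} (h : IndepFun U V μ)
    (hU : Measurable U) (hV : Measurable V) {s : Set (β × γ)} (hs : MeasurableSet s) :
    μ {ω | (U ω, V ω) ∈ s} = ∫⁻ ω, μ {ω' | (U ω', V ω) ∈ s} ∂μ := by
  have : IsProbabilityMeasure (μ.map U) := Measure.isProbabilityMeasure_map hU.aemeasurable
  have : IsProbabilityMeasure (μ.map V) := Measure.isProbabilityMeasure_map hV.aemeasurable
  have h1 := congrArg (fun ν => ν s)
    ((indepFun_iff_map_prod_eq_prod_map_map hU.aemeasurable hV.aemeasurable).1 h)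
  beta_reduce at h1
  rw [Measure.map_apply (hU.prodMk hV) hs, Measure.prod_apply_symm hs,
    lintegral_map (measurable_measure_prodMk_right hs) hV] at h1
  refine h1.trans (lintegral_congr fun ω => ?_)
  rw [Measure.map_apply hU (measurable_prodMk_right hs)]
  rfl

/-- The Laplace transform of a weighted sum of independent exponential variables. -/
lemma lintegral_expNeg_tsum_exponential {κ : Type*} [Countable κ] {X : κ → Ω → ℝ}
    (h : iIndepFun X μ) (hX : ∀ s, Measurable (X s)) (hlaw : ∀ s, HasLaw (X s) (expMeasure 1) μ)
    (c : κ → ℝ≥0∞) :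
    ∫⁻ ω, expNeg (∑' s, c s * ENNReal.ofReal (X s ω)) ∂μ = expNeg (∑' s, logOneAdd (c s)) := by
  have : IsProbabilityMeasure μ := h.isProbabilityMeasure
  have hL : Tendsto (fun t : Finset κ => ∫⁻ ω, expNeg (∑ s ∈ t, c s * ENNReal.ofReal (X s ω)) ∂μ)
      atTop (𝓝 (∫⁻ ω, expNeg (∑' s, c s * ENNReal.ofReal (X s ω)) ∂μ)) :=
    tendsto_lintegral_filter_of_dominated_convergence 1
      (.of_forall fun t => by fun_prop)
      (.of_forall fun t => .of_forall fun ω => expNeg_le_one _) (by simp)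
      (.of_forall fun ω => (continuous_expNeg.tendsto _).comp ENNReal.summable.hasSum)
  have hR : Tendsto (fun t : Finset κ => expNeg (∑ s ∈ t, logOneAdd (c s))) atTop
      (𝓝 (expNeg (∑' s, logOneAdd (c s)))) :=
    (continuous_expNeg.tendsto _).comp ENNReal.summable.hasSum
  refine tendsto_nhds_unique hL (hR.congr fun t => ?_)
  simp_rw [expNeg_sum]
  have hind := h.comp (fun s x => expNeg (c s * ENNReal.ofReal x)) (fun s => by fun_prop)
  refine Eq.symm ((lintegral_prod_eq_prod_lintegral_of_indepFun t _ hind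
    fun s => by fun_prop).trans (Finset.prod_congr rfl fun s _ => ?_))
  rw [expNeg_logOneAdd, ← lintegral_expNeg_expMeasure_one]
  exact (hlaw s).lintegral_comp (f := fun x => expNeg (c s * ENNReal.ofReal x)) (by fun_prop)

/-- The probability that independent exponential variables all exceed given thresholds. -/
lemma measure_forall_lt_exponential {ι : Type*} [Fintype ι] {X : ι → Ω → ℝ}
    (h : iIndepFun X μ) (hlaw : ∀ s, HasLaw (X s) (expMeasure 1) μ) (t : ι → ℝ≥0∞) :
    μ {ω | ∀ i, t i < ENNReal.ofReal (X i ω)} = expNeg (∑ i, t i) := by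
  have hm : ∀ i, MeasurableSet {x : ℝ | t i < ENNReal.ofReal x} := fun i =>
    measurableSet_lt measurable_const ENNReal.measurable_ofReal
  have h1 := h.measure_inter_preimage_eq_mul Finset.univ (sets := fun i =>
    {x : ℝ | t i < ENNReal.ofReal x}) (fun i _ => hm i)
  have h2 : {ω | ∀ i, t i < ENNReal.ofReal (X i ω)} =
      ⋂ i ∈ Finset.univ, X i ⁻¹' {x : ℝ | t i < ENNReal.ofReal x} := by
    ext; simp
  rw [h2, h1, expNeg_sum]
  refine Finset.prod_congr rfl fun i _ => ?_
  rw [← expMeasure_one_lt_ofReal, ← (hlaw i).map_eq,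
    Measure.map_apply_of_aemeasurable (hlaw i).aemeasurable (hm i)]

end Independence

/-! ### Competition between the route and a countable sum of faded signals. -/

section Fading

variable {Ω : Type*} [MeasurableSpace Ω] {μ : Measure Ω} [IsProbabilityMeasure μ]

/-- The mean of `snr α p h x y` under fading of unit mean power. -/
def meanSNR (α p : ℝ) (x y : Plane) : ℝ≥0∞ := ENNReal.ofReal p / ENNReal.ofReal (dist x y ^ α)

lemma snr_eq_meanSNR_mul {α p : ℝ} (hp : 0 ≤ p) (h : ℂ) (x y : Plane) :
    snr α p h x y = meanSNR α p x y * ENNReal.ofReal (‖h‖ ^ 2) := by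
  rw [snr, meanSNR, ENNReal.ofReal_mul hp, ENNReal.mul_div_right_comm]

@[fun_prop]
lemma measurable_meanSNR (α p : ℝ) (x : Plane) : Measurable (meanSNR α p x) := by
  unfold meanSNR
  fun_prop

/-- The event that the smallest of finitely many faded SNRs exceeds a countable sum of others,
all fading powers being independent exponential variables. -/
lemma measure_tsum_lt_iInf_exponential {ι κ : Type*} [Fintype ι] [Nonempty ι] [Countable κ]
    {X : ι ⊕ κ → Ω → ℝ} (h : iIndepFun X μ) (hX : ∀ s, Measurable (X s))
    (hlaw : ∀ s, HasLaw (X s) (expMeasure 1) μ) {u : ι → ℝ≥0∞} (hu0 : ∀ i, u i ≠ 0)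
    (hu : ∀ i, u i ≠ ∞) (w : κ → ℝ≥0∞) :
    μ {ω | ∑' s, w s * ENNReal.ofReal (X (.inr s) ω) <
        ⨅ i, u i * ENNReal.ofReal (X (.inl i) ω)} =
      expNeg (∑' s, logOneAdd ((∑ i, (u i)⁻¹) * w s)) := by
  have hsplit := h.indepFun_inl_inr hX
  let S : Set ((ι → ℝ) × (κ → ℝ)) :=
    {z | ∑' s, w s * ENNReal.ofReal (z.2 s) < ⨅ i, u i * ENNReal.ofReal (z.1 i)}
  have hS : MeasurableSet S := measurableSet_lt
    (.tsum fun s => by fun_prop) (.iInf fun i => by fun_prop)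
  refine (hsplit.measure_mk_mem (by fun_prop) (by fun_prop) hS).trans ?_
  have hinl := h.precomp (Sum.inl_injective (α := ι) (β := κ))
  have hinr := h.precomp (Sum.inr_injective (α := ι) (β := κ))
  have hcond : ∀ t : ℝ≥0∞, μ {ω | t < ⨅ i, u i * ENNReal.ofReal (X (.inl i) ω)} =
      expNeg ((∑ i, (u i)⁻¹) * t) := by
    intro t
    rw [Finset.sum_mul, ← measure_forall_lt_exponential hinl (fun i => hlaw (.inl i))]
    congr 1
    ext ω
    simp only [Set.mem_ofPred_eq]
    have hlt : ∀ i, (u i)⁻¹ * t < ENNReal.ofReal (X (.inl i) ω) ↔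
        t < u i * ENNReal.ofReal (X (.inl i) ω) := fun i => by
      rw [mul_comm, ← ENNReal.div_eq_inv_mul.trans (mul_comm _ _), mul_comm (u i),
        ENNReal.div_lt_iff (.inl (hu0 i)) (.inl (hu i))]
    simp_rw [hlt]
    -- A finite nonempty infimum is attained, so strict inequality passes to it.
    exact ⟨fun h i => h.trans_le (iInf_le _ i), fun h => by
      obtain ⟨i, hi⟩ := exists_eq_ciInf_of_finite
        (f := fun i => u i * ENNReal.ofReal (X (.inl i) ω))
      exact hi ▸ h i⟩
  rw [← lintegral_expNeg_tsum_exponential hinr (fun s => hX (.inr s)) (fun s => hlaw (.inr s))]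
  refine lintegral_congr fun ω =>
    (hcond (∑' s, w s * ENNReal.ofReal (X (.inr s) ω))).trans ?_
  simp_rw [← ENNReal.tsum_mul_left, ← mul_assoc]

end Fading

/-- This includes S = I = ∞, since ∞ - ∞ is `⊥` in `EReal`. -/
lemma secrecyRate_pos_iff {N : ℕ} (hN : 1 ≤ N) (S I : ℝ≥0∞) : 0 < secrecyRate N S I ↔ I < S := by
  have hN' : 0 < 1 / (N : ℝ) := by positivity
  have hlog : 0 < ((Real.log 2 : ℝ) : EReal) := EReal.coe_pos.2 (Real.log_pos one_lt_two)
  have h0 : 0 < ((1 / (N : ℝ) : ℝ) : EReal) := EReal.coe_pos.2 hN'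
  rw [secrecyRate, EReal.mul_pos_iff]
  simp only [h0, true_and, h0.not_gt, false_and, or_false]
  rw [EReal.sub_pos, elog2, elog2, (EReal.strictMono_div_right_of_pos hlog (EReal.coe_ne_top _)).lt_iff_lt,
    log_lt_log_iff, ENNReal.add_lt_add_iff_left one_ne_top]

/-! ### The integrand: bounds, integrability, and its form as 1 - e^{-f}. -/

section Integrand

variable {N : ℕ} {α : ℝ} {A : Fin (N + 1) → Plane} {p : Fin N → ℝ}

lemma sum_dist_rpow_div_nonneg (hp : ∀ i, 0 < p i) :
    0 ≤ ∑ i : Fin N, dist (A i.castSucc) (A i.succ) ^ α / p i :=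
  Finset.sum_nonneg fun i _ => div_nonneg (Real.rpow_nonneg dist_nonneg _) (hp i).le

lemma integrand_factor_mem_Icc {C D : ℝ} (hC : 0 ≤ C) (hD : 0 ≤ D) :
    1 / (1 + C / D) ∈ Set.Icc (0 : ℝ) 1 := by
  have : 0 ≤ C / D := div_nonneg hC hD
  exact ⟨by positivity, by rw [div_le_one (by positivity)]; linarith⟩

lemma colludingIntegrand_factor_mem_Icc (hp : ∀ i, 0 < p i) (k : Fin N) (x : Plane) :
    1 / (1 + p k / dist (A k.castSucc) x ^ α *
      ∑ i : Fin N, dist (A i.castSucc) (A i.succ) ^ α / p i) ∈ Set.Icc (0 : ℝ) 1 := by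
  rw [div_mul_eq_mul_div]
  exact integrand_factor_mem_Icc (mul_nonneg (hp k).le (sum_dist_rpow_div_nonneg hp))
    (Real.rpow_nonneg dist_nonneg _)

lemma colludingIntegrand_nonneg (hp : ∀ i, 0 < p i) (x : Plane) :
    0 ≤ colludingIntegrand α A p x :=
  sub_nonneg.2 (Finset.prod_le_one (fun k _ => (colludingIntegrand_factor_mem_Icc hp k x).1)
    fun k _ => (colludingIntegrand_factor_mem_Icc hp k x).2)

lemma measurable_colludingIntegrand : Measurable (colludingIntegrand α A p) := by
  unfold colludingIntegrand
  fun_prop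

/-- A union bound; it reduces integrability to one transmitter at a time. -/
lemma one_sub_prod_le_sum {ι : Type*} (s : Finset ι) {y : ι → ℝ}
    (hy : ∀ i, y i ∈ Set.Icc (0 : ℝ) 1) : 1 - ∏ i ∈ s, y i ≤ ∑ i ∈ s, (1 - y i) := by
  classical
  induction s using Finset.induction_on with
  | empty => simp
  | insert a s ha ih =>
    rw [Finset.prod_insert ha, Finset.sum_insert ha]
    have h0 : 0 ≤ ∏ i ∈ s, y i := Finset.prod_nonneg fun i _ => (hy i).1
    have h1 : ∏ i ∈ s, y i ≤ 1 := Finset.prod_le_one (fun i _ => (hy i).1) fun i _ => (hy i).2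
    nlinarith [(hy a).1, (hy a).2]

lemma one_add_rpow_le {d α : ℝ} (hd : 0 ≤ d) (hα : 0 < α) :
    (1 + d) ^ α ≤ 2 ^ α * (1 + d ^ α) := by
  have h1 : 1 + d ≤ 2 * max 1 d := by
    linarith [le_max_left 1 d, le_max_right 1 d]
  have h2 : (max 1 d) ^ α ≤ 1 + d ^ α := by
    rcases max_cases 1 d with h | h <;> rw [h.1]
    · rw [Real.one_rpow]; linarith [Real.rpow_nonneg hd α]
    · linarith
  calc (1 + d) ^ α ≤ (2 * max 1 d) ^ α := Real.rpow_le_rpow (by linarith) h1 hα.le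
    _ = 2 ^ α * (max 1 d) ^ α := Real.mul_rpow (by norm_num) (by positivity)
    _ ≤ _ := by gcongr

/-- The left side equals C/(d^α + C) for d > 0: bounded near the node and of order d^{-α} far away,
hence dominated by a multiple of (1 + d)^{-α}. -/
lemma one_sub_integrand_factor_le {C d α : ℝ} (hC : 0 ≤ C) (hd : 0 ≤ d) (hα : 0 < α) :
    1 - 1 / (1 + C / d ^ α) ≤ 2 ^ α * (1 + C) * (1 + d) ^ (-α) := by
  rcases hd.eq_or_lt with rfl | hd'
  -- At d = 0 division by zero makes the left side 0.
  · rw [Real.zero_rpow hα.ne']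
    norm_num
    positivity
  have hD : 0 < d ^ α := Real.rpow_pos_of_pos hd' _
  have h1 : 1 - 1 / (1 + C / d ^ α) = C / (d ^ α + C) := by
    field_simp
    ring
  have h2 := one_add_rpow_le hd hα
  have h3 : 0 < (2 : ℝ) ^ α := by positivity
  rw [h1, Real.rpow_neg (by positivity), ← div_eq_mul_inv,
    div_le_div_iff₀ (by positivity) (by positivity)]
  calc C * (1 + d) ^ α ≤ C * (2 ^ α * (1 + d ^ α)) := by gcongr
    _ = 2 ^ α * (C * (1 + d ^ α)) := by ring
    _ ≤ 2 ^ α * ((1 + C) * (d ^ α + C)) := by gcongr ?_ * ?_; nlinarith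
    _ = _ := by ring

/-- For path loss exponents above the dimension of the plane, the integrand is integrable. -/
lemma integrable_colludingIntegrand (hp : ∀ i, 0 < p i) (hα : 2 < α) :
    Integrable (colludingIntegrand α A p) := by
  have hint : ∀ a : Plane, Integrable fun x => (1 + dist a x) ^ (-α) := by
    intro a
    have h : Integrable fun x : Plane => (1 + ‖x‖) ^ (-α) :=
      integrable_one_add_norm (by simpa using hα)
    simpa [dist_eq_norm] using h.comp_sub_left a
  set σ := ∑ i : Fin N, dist (A i.castSucc) (A i.succ) ^ α / p i with hσ
  have hσ0 : 0 ≤ σ := sum_dist_rpow_div_nonneg hp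
  have hbound : Integrable fun x => ∑ k : Fin N,
      2 ^ α * (1 + p k * σ) * (1 + dist (A k.castSucc) x) ^ (-α) :=
    integrable_finsetSum _ fun k _ => (hint _).const_mul _
  refine hbound.mono' measurable_colludingIntegrand.aestronglyMeasurable (.of_forall fun x => ?_)
  rw [Real.norm_of_nonneg (colludingIntegrand_nonneg hp x)]
  refine (one_sub_prod_le_sum _ fun k => colludingIntegrand_factor_mem_Icc hp k x).trans
    (Finset.sum_le_sum fun k _ => ?_)
  rw [← hσ, div_mul_eq_mul_div]
  exact one_sub_integrand_factor_le (mul_nonneg (hp k).le hσ0) dist_nonneg (by linarith)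

lemma sum_inv_meanSNR (hp : ∀ i, 0 < p i)
    (hAne : ∀ i : Fin N, A i.castSucc ≠ A i.succ) :
    ∑ i : Fin N, (meanSNR α (p i) (A i.castSucc) (A i.succ))⁻¹ =
      ENNReal.ofReal (∑ i : Fin N, dist (A i.castSucc) (A i.succ) ^ α / p i) := by
  rw [ENNReal.ofReal_sum_of_nonneg
    fun i _ => div_nonneg (Real.rpow_nonneg dist_nonneg _) (hp i).le]
  refine Finset.sum_congr rfl fun i _ => ?_
  have hd : 0 < dist (A i.castSucc) (A i.succ) ^ α := Real.rpow_pos_of_pos (dist_pos.2 (hAne i)) _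
  rw [meanSNR, ← ENNReal.ofReal_div_of_pos hd, ← ENNReal.ofReal_inv_of_pos (div_pos (hp i) hd),
    inv_div]

/-- Away from the nodes, the integrand is `1 - exp (-f)` for the total effect `f` of one
eavesdropper. -/
lemma one_sub_expNeg_sum_logOneAdd (hp : ∀ i, 0 < p i)
    (hAne : ∀ i : Fin N, A i.castSucc ≠ A i.succ) {x : Plane} (hx : ∀ k, A k ≠ x) :
    1 - expNeg (∑ k : Fin N, logOneAdd
      ((∑ i : Fin N, (meanSNR α (p i) (A i.castSucc) (A i.succ))⁻¹) *
        meanSNR α (p k) (A k.castSucc) x)) = ENNReal.ofReal (colludingIntegrand α A p x) := by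
  rw [colludingIntegrand, ENNReal.ofReal_sub _
    (Finset.prod_nonneg fun k _ => (colludingIntegrand_factor_mem_Icc hp k x).1),
    ENNReal.ofReal_one, ENNReal.ofReal_prod_of_nonneg
    (fun k _ => (colludingIntegrand_factor_mem_Icc hp k x).1), expNeg_sum,
    sum_inv_meanSNR hp hAne]
  congr 1
  refine Finset.prod_congr rfl fun k _ => ?_
  have hσ := sum_dist_rpow_div_nonneg (α := α) (A := A) hp
  have hd : 0 < dist (A k.castSucc) x ^ α := Real.rpow_pos_of_pos (dist_pos.2 (hx _)) _
  have hq : 0 ≤ p k / dist (A k.castSucc) x ^ α *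
      ∑ i : Fin N, dist (A i.castSucc) (A i.succ) ^ α / p i :=
    mul_nonneg (div_pos (hp k) hd).le hσ
  rw [expNeg_logOneAdd, meanSNR, ← ENNReal.ofReal_div_of_pos hd, ← ENNReal.ofReal_mul hσ,
    mul_comm (∑ i : Fin N, _), ← ENNReal.ofReal_one, ← ENNReal.ofReal_add zero_le_one hq,
    one_div, ENNReal.ofReal_inv_of_pos (by linarith)]

end Integrand

/-! ### Assembly: averaging over the eavesdroppers' locations. -/

section SecureConnection

variable {Ω : Type*} {N : ℕ}
  {α : ℝ} {A : Fin (N + 1) → Plane} {p : Fin N → ℝ} {hA : Fin N → Ω → ℂ}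
  {hE : Fin N → ℕ → Ω → ℂ} {E : ℕ → Ω → Plane}

lemma routeSNR_eq (hp : ∀ i, 0 < p i) (ω : Ω) :
    routeSNR α A p (fun i => hA i ω) =
      ⨅ i : Fin N, meanSNR α (p i) (A i.castSucc) (A i.succ) *
        ENNReal.ofReal (fadingPower hA hE (.inl i) ω) := by
  simp_rw [routeSNR, snr_eq_meanSNR_mul (hp _).le]
  rfl

lemma colludingSNR_eq (hp : ∀ i, 0 < p i) (y : ℕ → Plane) (ω : Ω) :
    colludingSNR α A p y (fun k j => hE k j ω) =
      ∑' s : Fin N × ℕ, meanSNR α (p s.1) (A s.1.castSucc) (y s.2) *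
        ENNReal.ofReal (fadingPower hA hE (.inr s) ω) := by
  simp_rw [colludingSNR, snr_eq_meanSNR_mul (hp _).le]
  rw [ENNReal.tsum_prod', ENNReal.tsum_comm]
  exact tsum_congr fun j => (tsum_fintype _).symm

variable [MeasurableSpace Ω] {μ : Measure Ω}

namespace IsRayleighFading

lemma measurable_fadingPower (h : IsRayleighFading μ hA hE E) (s : Fin N ⊕ (Fin N × ℕ)) :
    Measurable (fadingPower hA hE s) := by
  rcases s with i | ⟨k, j⟩
  · exact (h.measurable_hA i).norm.pow_const 2
  · exact (h.measurable_hE k j).norm.pow_const 2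

variable [IsProbabilityMeasure μ]

/-- The probability that a fixed set of eavesdroppers is beaten by the route. -/
lemma measure_colludingSNR_lt_routeSNR (h : IsRayleighFading μ hA hE E) (hN : 1 ≤ N)
    (hAne : ∀ i : Fin N, A i.castSucc ≠ A i.succ) (hp : ∀ i, 0 < p i)
    (y : ℕ → Plane) :
    μ {ω | colludingSNR α A p y (fun k j => hE k j ω) < routeSNR α A p (fun i => hA i ω)} =
      expNeg (∑' j, ∑ k : Fin N, logOneAdd
        ((∑ i : Fin N, (meanSNR α (p i) (A i.castSucc) (A i.succ))⁻¹) *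
          meanSNR α (p k) (A k.castSucc) (y j))) := by
  have : Nonempty (Fin N) := ⟨⟨0, hN⟩⟩
  have hd : ∀ i : Fin N, 0 < dist (A i.castSucc) (A i.succ) ^ α := fun i =>
    Real.rpow_pos_of_pos (dist_pos.2 (hAne i)) _
  have hu : ∀ i : Fin N, meanSNR α (p i) (A i.castSucc) (A i.succ) =
      ENNReal.ofReal (p i / dist (A i.castSucc) (A i.succ) ^ α) := fun i =>
    (ENNReal.ofReal_div_of_pos (hd i)).symm
  simp_rw [colludingSNR_eq (hA := hA) hp, routeSNR_eq (hE := hE) hp]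
  rw [measure_tsum_lt_iInf_exponential h.indep h.measurable_fadingPower h.law
    (u := fun i => meanSNR α (p i) (A i.castSucc) (A i.succ))
    (fun i => by rw [hu]; simpa using div_pos (hp i) (hd i)) (fun i => by rw [hu]; simp)
    (fun s => meanSNR α (p s.1) (A s.1.castSucc) (y s.2)), ENNReal.tsum_prod', ENNReal.tsum_comm]
  congr 1
  exact tsum_congr fun j => tsum_fintype _

end IsRayleighFading

lemma colludingSCP_eq_expNeg [IsProbabilityMeasure μ] {lam : ℝ≥0} (hN : 1 ≤ N)
    (hAne : ∀ i : Fin N, A i.castSucc ≠ A i.succ) (hp : ∀ i, 0 < p i)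
    (hPPP : IsHomogeneousPPP μ lam E) (hfading : IsRayleighFading μ hA hE E) :
    colludingSCP μ α A p hA hE E =
      expNeg (lam * ∫⁻ x : Plane, ENNReal.ofReal (colludingIntegrand α A p x)) := by
  -- The event as a measurable set of pairs (fading powers, locations), so that the locations can be
  -- frozen.
  let S : Set ((Fin N ⊕ (Fin N × ℕ) → ℝ) × (ℕ → Plane)) :=
    {z | ∑' s : Fin N × ℕ, meanSNR α (p s.1) (A s.1.castSucc) (z.2 s.2) *
        ENNReal.ofReal (z.1 (.inr s)) <
      ⨅ i : Fin N, meanSNR α (p i) (A i.castSucc) (A i.succ) * ENNReal.ofReal (z.1 (.inl i))}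
  have hS : MeasurableSet S := measurableSet_lt
    (.tsum fun s => by fun_prop) (.iInf fun i => by fun_prop)
  have hmem : ∀ (ω : Ω) (y : ℕ → Plane), ((fun s => fadingPower hA hE s ω, y) ∈ S ↔
      colludingSNR α A p y (fun k j => hE k j ω) < routeSNR α A p (fun i => hA i ω)) := by
    intro ω y
    rw [colludingSNR_eq (hA := hA) hp, routeSNR_eq (hE := hE) hp]
    rfl
  let f : Plane → ℝ≥0∞ := fun x => ∑ k : Fin N, logOneAdd
    ((∑ i : Fin N, (meanSNR α (p i) (A i.castSucc) (A i.succ))⁻¹) *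
      meanSNR α (p k) (A k.castSucc) x)
  have hf : Measurable f := by fun_prop
  calc colludingSCP μ α A p hA hE E
      = μ {ω | ((fun s => fadingPower hA hE s ω, fun j => E j ω) :
          (Fin N ⊕ (Fin N × ℕ) → ℝ) × (ℕ → Plane)) ∈ S} := by
        simp_rw [colludingSCP, secrecyRate_pos_iff hN, hmem]
    _ = ∫⁻ ω, μ {ω' | ((fun s => fadingPower hA hE s ω', fun j => E j ω) :
          (Fin N ⊕ (Fin N × ℕ) → ℝ) × (ℕ → Plane)) ∈ S} ∂μ :=
        hfading.indep_locations.measure_mk_mem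
          (measurable_pi_lambda _ hfading.measurable_fadingPower)
          (measurable_pi_lambda _ hPPP.measurable) hS
    _ = ∫⁻ ω, expNeg (∑' j, f (E j ω)) ∂μ := by
        simp_rw [hmem]
        exact lintegral_congr fun ω =>
          hfading.measure_colludingSNR_lt_routeSNR hN hAne hp fun j => E j ω
    _ = expNeg (lam * ∫⁻ x, (1 - expNeg (f x))) := hPPP.lintegral_expNeg_tsum hf
    _ = _ := by
        congr 2
        refine lintegral_congr_ae ?_
        -- At a transmitting node with α ≠ 0, `meanSNR` is ∞ while the real quotient is 0; nodes
        -- form a null set.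
        have hnull : ∀ᵐ x : Plane, ∀ k, A k ≠ x :=
          ae_all_iff.2 fun k => (Measure.ae_ne volume (A k)).mono fun x hx => hx.symm
        filter_upwards [hnull] with x hx
        exact one_sub_expNeg_sum_logOneAdd hp hAne hx

end SecureConnection

end

theorem mainTheorem1 {Ω : Type*} [MeasurableSpace Ω] (μ : Measure Ω) [IsProbabilityMeasure μ]
    (N : ℕ) (hN : 1 ≤ N) (α : ℝ) (hα : 0 < α) (lam : ℝ≥0) (hlam : 0 < lam)
    (A : Fin (N + 1) → Plane) (hAne : ∀ i : Fin N, A i.castSucc ≠ A i.succ)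
    (p : Fin N → ℝ) (hp : ∀ i, 0 < p i)
    (hA : Fin N → Ω → ℂ) (hE : Fin N → ℕ → Ω → ℂ) (E : ℕ → Ω → Plane)
    (hPPP : IsHomogeneousPPP μ lam E) (hfading : IsRayleighFading μ hA hE E) :
    colludingSCP μ α A p hA hE E =
        EReal.exp (-((lam * ∫⁻ x : Plane, ENNReal.ofReal (colludingIntegrand α A p x) : ℝ≥0∞) :
          EReal)) ∧
      (2 < α → Integrable (colludingIntegrand α A p) ∧
        (colludingSCP μ α A p hA hE E).toReal =
          Real.exp (-(lam * ∫ x : Plane, colludingIntegrand α A p x))) := by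
  have hSCP := colludingSCP_eq_expNeg (α := α) hN hAne hp hPPP hfading
  -- The first claim is `hSCP` itself, with `expNeg` unfolded.
  refine ⟨hSCP, fun hα2 => ?_⟩
  have hint : Integrable (colludingIntegrand α A p) := integrable_colludingIntegrand hp hα2
  refine ⟨hint, ?_⟩
  have h0 : 0 ≤ ∫ x : Plane, colludingIntegrand α A p x :=
    integral_nonneg (colludingIntegrand_nonneg hp)
  rw [hSCP, ← ofReal_integral_eq_lintegral_ofReal hint
    (.of_forall (colludingIntegrand_nonneg hp)), ← ENNReal.ofReal_coe_nnreal,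
    ← ENNReal.ofReal_mul lam.coe_nonneg, ENNReal.expNeg_ofReal (mul_nonneg lam.coe_nonneg h0),
    ENNReal.toReal_ofReal (Real.exp_nonneg _)]
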